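/- **Conventions.** A left brace is a set $B$ with an abelian group structure $(B,+)$ and a group structure $(B,\cdot)$ such that $a(b+c)+a=ab+ac$ for all $a,b,c$; its lambda map is $\lambda_a(b)=-a+ab$, and its socle is the ideal $\operatorname{soc}(B)=\{a\in B: ab=a+b\text{ for all }b\in B\}$. A homomorphism of left braces is a map preserving $+$ and $\cdot$. The solution of the Yang–Baxter equation associated to $B$ is $r_B(a,b)=(\lambda_a(b),\lambda_{\lambda_a(b)}^{-1}(a))$. For an involutive non-degenerate set-theoretic solution $(X,r)$, $r(x,y)=(\sigma_x(y),\gamma_y(x))$, the structure group $G(X,r)=\langle X\mid xy=\sigma_x(y)\gamma_y(x)\ (x,y\in X)\rangle$ carries its natural left brace structure, with $\lambda_x(y)=\sigma_x(y)$ for $x,y\in X$, and the permutation group $\mathcal G(X,r)=\langle\sigma_x: x\in X\rangle\le \mathrm{Sym}_X$ carries the unique left brace structure, with composition as multiplication, for which $G(X,r)\to\mathcal G(X,r)$, $x\mapsto\sigma_x$, is a homomorphism of left braces. **Setting.** Let $A$ be an additive abelian group of finite exponent $n>1$, let $t\in\operatorname{Aut}(A)$ be such that $t-\mathrm{id}\in\operatorname{Aut}(A)$,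 and let $T=\langle t\rangle\le\operatorname{Aut}(A)$. Let $(j_a)_{a\in A}$ be a family of elements of $A$ with $j_a=j_{-a}$ and $j_{t^z(a)}=t^z(j_a)-(t^z-\mathrm{id})(j_0)$ for all $a\in A$, $z\in\mathbb Z$. Let $A_1=A\rtimes T$ be the left brace with $$(a,u)+(c,v)=(a+c,uv),\qquad (a,u)(c,v)=(a+u(c),uv).$$ Let $H'$ be the additive group of finitely supported functions $A\to\mathbb Z/(n)$. Let $A_1$ act on $H'$ by $\alpha'(a,t^z)(f)=f\circ g_{(a,t^z)}$, where $$g_{(a,t^z)}(x)=t^{-z}\bigl(x-a-(t-\mathrm{id})^{-2}(t^{z+1}-t)(j_0)\bigr),$$ and let $b'\colon H'\times H'\to A_1$ be the bilinear form $$b'(f,h)=\Bigl(\sum_{x,y\in A}f(x)h(y)\,t(j_{x-y}-j_0),\ \mathrm{id}\Bigr).$$ Let $B'=H'\rtimes_\circ A_1$ be the asymmetric product, that is, the left brace on $H'\times A_1$ with $$(f,p)(h,q)=(f+\alpha'(p)(h),\,pq),\qquad (f,p)+(h,q)=(f+h,\ p+q+b'(f,h)).$$ For $a,c\in A$ put $x'_{(a,c)}=(e'_a,(c-t(t-\mathrm{id})^{-1}(j_0),t))\in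 B'$, where $e'_a(a)=1$ and $e'_a(x)=0$ for $x\ne a$. Let $X'=\{x'_{(a,c)}: a,c\in A\}$ and let $r'$ be the restriction to $X'\times X'$ of the solution $r_{B'}$; then $(X',r')$ is a solution. **Proposition.** Suppose that the order of $t$ is finite and coprime to $n$. Then $$B'/\operatorname{soc}(B')\cong\mathcal G(X',r')$$ as left braces, and $$\operatorname{soc}(B')=\{(f,(0,\mathrm{id})): f\in H',\ b'(f,h)=(0,\mathrm{id})\text{ for all }h\in H'\}.$$ Moreover, the left braces $B'$ and $\mathcal G(X',r')$ are isomorphic if and only if $b'$ is non-singular, i.e. the only $f\in H'$ with $b'(f,h)=(0,\mathrm{id})$ for all $h\in H'$ is $f=0$. -/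

import Mathlib

/-! ### Left braces -/

/-- A left brace: an abelian group `(B, +)` and a group `(B, *)` on the same set such that
`a * (b + c) + a = a * b + a * c`. -/
class LeftBrace (B : Type*) extends AddCommGroup B, Group B where
  brace_eq : ∀ a b c : B, a * (b + c) + a = a * b + a * c

namespace LeftBrace

variable {B : Type*} [LeftBrace B]

theorem mul_add' (a b c : B) : a * (b + c) = a * b + a * c - a := by
  rw [← brace_eq]; abel

theorem mul_zero' (a : B) : a * 0 = a := by
  have h := brace_eq a 0 0
  rw [add_zero] at h
  exact (add_left_cancel h).symm

theorem one_eq_zero : (1 : B) = 0 := by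
  have h := mul_zero' (1 : B)
  rw [one_mul] at h
  exact h.symm

theorem mul_neg' (a b : B) : a * (-b) = a + a - a * b := by
  have h := brace_eq a b (-b)
  rw [add_neg_cancel, mul_zero'] at h
  rw [h]; abel

/-- The lambda map `λ_a (b) = -a + a * b`, an automorphism of the additive group. -/
def lam (a : B) : B ≃+ B where
  toFun b := -a + a * b
  invFun b := -a⁻¹ + a⁻¹ * b
  left_inv b := by
    change -a⁻¹ + a⁻¹ * (-a + a * b) = b
    rw [mul_add', mul_neg', inv_mul_cancel, inv_mul_cancel_left, one_eq_zero]; abel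
  right_inv b := by
    change -a + a * (-a⁻¹ + a⁻¹ * b) = b
    rw [mul_add', mul_neg', mul_inv_cancel, mul_inv_cancel_left, one_eq_zero]; abel
  map_add' b c := by rw [mul_add']; abel

theorem lam_apply (a b : B) : lam a b = -a + a * b := rfl

theorem lam_symm_apply (a b : B) : (lam a).symm b = lam a⁻¹ b := rfl

theorem add_lam (a b : B) : a + lam a b = a * b := by rw [lam_apply]; abel

theorem lam_mul (a b c : B) : lam (a * b) c = lam a (lam b c) := by
  simp only [lam_apply]
  rw [mul_add', mul_neg', mul_assoc]; abel

theorem lam_one (c : B) : lam 1 c = c := by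
  rw [lam_apply, one_mul, one_eq_zero, neg_zero, zero_add]

theorem lam_inv_lam (a c : B) : lam a⁻¹ (lam a c) = c := by
  rw [← lam_mul, inv_mul_cancel, lam_one]

theorem lam_lam_inv (a c : B) : lam a (lam a⁻¹ c) = c := by
  rw [← lam_mul, mul_inv_cancel, lam_one]

/-- `a + b = a * λ_a⁻¹ (b)`. -/
theorem add_eq_mul_lam (a b : B) : a + b = a * lam a⁻¹ b := by
  rw [← add_lam, lam_lam_inv]

/-- `λ_a (b) (γ_b (a)) = a b`, where `γ_b (a) = λ_{λ_a (b)}⁻¹ (a)`. -/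
theorem gam_eq (a b : B) : (lam (lam a b)).symm a = (lam a b)⁻¹ * (a * b) := by
  rw [lam_symm_apply, ← add_lam a b, add_comm a, add_eq_mul_lam (lam a b) a, inv_mul_cancel_left]

/-- An ideal of a left brace: a normal subgroup of the multiplicative group that is invariant
under all the maps `λ_a`. -/
structure Ideal (B : Type*) [LeftBrace B] extends Subgroup B where
  normal : toSubgroup.Normal
  lam_mem : ∀ (a : B) {b : B}, b ∈ carrier → lam a b ∈ carrier

namespace Ideal

variable (I : Ideal B)

/-- The underlying additive subgroup of an ideal. -/
def toAddSubgroup : AddSubgroup B where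
  carrier := {a | a ∈ I.toSubgroup}
  zero_mem' := by
    have h := I.toSubgroup.one_mem
    rw [one_eq_zero] at h
    exact h
  add_mem' {a b} ha hb := by
    change a + b ∈ I.toSubgroup
    rw [add_eq_mul_lam]
    exact I.toSubgroup.mul_mem ha (I.lam_mem _ hb)
  neg_mem' {a} ha := by
    change -a ∈ I.toSubgroup
    have h : -a = lam a a⁻¹ := by rw [lam_apply, mul_inv_cancel, one_eq_zero, add_zero]
    rw [h]
    exact I.lam_mem _ (I.toSubgroup.inv_mem ha)

theorem mem_toAddSubgroup {a : B} : a ∈ I.toAddSubgroup ↔ a ∈ I.toSubgroup := Iff.rfl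

/-- Additive and multiplicative cosets of an ideal agree. -/
theorem neg_add_mem_iff (a b : B) : -a + b ∈ I.toAddSubgroup ↔ a⁻¹ * b ∈ I.toSubgroup := by
  have h : a⁻¹ * b = lam a⁻¹ (-a + b) := by
    rw [lam_apply, mul_add', mul_neg', inv_mul_cancel, one_eq_zero]; abel
  rw [mem_toAddSubgroup, h]
  refine ⟨fun k => I.lam_mem _ k, fun k => ?_⟩
  have := I.lam_mem a k
  rw [lam_lam_inv] at this
  exact this

/-- The quotient of a left brace by an ideal, as the set of cosets. -/
def Quotient : Type _ := B ⧸ I.toAddSubgroup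

instance : AddCommGroup I.Quotient :=
  inferInstanceAs (AddCommGroup (B ⧸ I.toAddSubgroup))

/-- The class of an element in the quotient left brace. -/
def toQuot (a : B) : I.Quotient := QuotientAddGroup.mk a

theorem toQuot_surjective (x : I.Quotient) : ∃ a, I.toQuot a = x := QuotientAddGroup.mk_surjective x

theorem toQuot_eq_iff {a b : B} : I.toQuot a = I.toQuot b ↔ a⁻¹ * b ∈ I.toSubgroup := by
  rw [← neg_add_mem_iff]
  exact QuotientAddGroup.eq

theorem toQuot_add (a b : B) : I.toQuot (a + b) = I.toQuot a + I.toQuot b := rfl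

/-- Multiplication of classes. -/
instance : Mul I.Quotient :=
  ⟨_root_.Quotient.map₂ (fun a b => a * b) (by
    intro a a' ha b b' hb
    refine _root_.Quotient.exact (?_ : I.toQuot (a * b) = I.toQuot (a' * b'))
    have ha' : I.toQuot a = I.toQuot a' := _root_.Quotient.sound ha
    have hb' : I.toQuot b = I.toQuot b' := _root_.Quotient.sound hb
    rw [toQuot_eq_iff] at ha' hb' ⊢
    have e : (a * b)⁻¹ * (a' * b') = (b⁻¹ * (a⁻¹ * a') * b⁻¹⁻¹) * (b⁻¹ * b') := by group
    rw [e]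
    exact I.toSubgroup.mul_mem (I.normal.conj_mem _ ha' _) hb')⟩

theorem toQuot_mul (a b : B) : I.toQuot (a * b) = I.toQuot a * I.toQuot b := rfl

/-- Inverses of classes. -/
instance : Inv I.Quotient :=
  ⟨_root_.Quotient.map (fun a => a⁻¹) (by
    intro a a' ha
    refine _root_.Quotient.exact (?_ : I.toQuot a⁻¹ = I.toQuot a'⁻¹)
    have ha' : I.toQuot a = I.toQuot a' := _root_.Quotient.sound ha
    rw [toQuot_eq_iff] at ha' ⊢
    have e : a⁻¹⁻¹ * a'⁻¹ = (a * (a⁻¹ * a') * a⁻¹)⁻¹ := by group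
    rw [e]
    exact I.toSubgroup.inv_mem (I.normal.conj_mem _ ha' _))⟩

theorem toQuot_inv (a : B) : I.toQuot a⁻¹ = (I.toQuot a)⁻¹ := rfl

instance : One I.Quotient := ⟨I.toQuot 1⟩

theorem toQuot_one : I.toQuot 1 = 1 := rfl

instance : Group I.Quotient :=
  Group.ofLeftAxioms
    (by
      intro x y z
      obtain ⟨a, rfl⟩ := I.toQuot_surjective x
      obtain ⟨b, rfl⟩ := I.toQuot_surjective y
      obtain ⟨c, rfl⟩ := I.toQuot_surjective z
      rw [← toQuot_mul, ← toQuot_mul, ← toQuot_mul, ← toQuot_mul, mul_assoc])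
    (by
      intro x
      obtain ⟨a, rfl⟩ := I.toQuot_surjective x
      rw [← toQuot_one, ← toQuot_mul, one_mul])
    (by
      intro x
      obtain ⟨a, rfl⟩ := I.toQuot_surjective x
      rw [← toQuot_inv, ← toQuot_mul, inv_mul_cancel, toQuot_one])

/-- The quotient left brace `B / I`. -/
instance : LeftBrace I.Quotient where
  brace_eq x y z := by
    obtain ⟨a, rfl⟩ := I.toQuot_surjective x
    obtain ⟨b, rfl⟩ := I.toQuot_surjective y
    obtain ⟨c, rfl⟩ := I.toQuot_surjective z
    rw [← toQuot_add, ← toQuot_mul, ← toQuot_add, brace_eq, ← toQuot_mul, ← toQuot_mul, toQuot_add]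

end Ideal

theorem mul_eq_add_iff (a : B) : (∀ b, a * b = a + b) ↔ ∀ b, lam a b = b := by
  refine forall_congr' fun b => ?_
  rw [← add_lam]
  exact add_right_inj a

/-- The socle `{a | a * b = a + b for all b}`, which is an ideal. -/
def socle (B : Type*) [LeftBrace B] : Ideal B where
  carrier := {a | ∀ b : B, a * b = a + b}
  one_mem' b := by rw [one_mul, one_eq_zero, zero_add]
  mul_mem' {a c} ha hc := by
    refine (mul_eq_add_iff (a * c)).2 fun b => ?_
    rw [lam_mul, (mul_eq_add_iff c).1 hc, (mul_eq_add_iff a).1 ha]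
  inv_mem' {a} ha := by
    refine (mul_eq_add_iff a⁻¹).2 fun b => ?_
    have h := lam_inv_lam a b
    rwa [(mul_eq_add_iff a).1 ha] at h
  normal := ⟨fun a ha g => by
    refine (mul_eq_add_iff (g * a * g⁻¹)).2 fun b => ?_
    rw [lam_mul, lam_mul, (mul_eq_add_iff a).1 ha, lam_lam_inv]⟩
  lam_mem g {a} ha := by
    have hconj : lam g a = g * a * g⁻¹ := by
      have hg : ∀ x, (g * a * g⁻¹) * x = g * a * g⁻¹ + x := by
        refine (mul_eq_add_iff (g * a * g⁻¹)).2 fun b => ?_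
        rw [lam_mul, lam_mul, (mul_eq_add_iff a).1 ha, lam_lam_inv]
      have h := hg g
      rw [inv_mul_cancel_right] at h
      have h' : lam g a = -g + (g * a * g⁻¹ + g) := congrArg (fun x => -g + x) h
      rw [h', add_comm (g * a * g⁻¹), neg_add_cancel_left]
    rw [hconj]
    refine (mul_eq_add_iff (g * a * g⁻¹)).2 fun b => ?_
    rw [lam_mul, lam_mul, (mul_eq_add_iff a).1 ha, lam_lam_inv]

end LeftBrace

/-! ### Solutions of the Yang--Baxter equation -/

/-- `r × id` on `X³`. -/
def ybe12 {X : Type*} (r : X × X → X × X) (p : X × X × X) : X × X × X :=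
  ((r (p.1, p.2.1)).1, (r (p.1, p.2.1)).2, p.2.2)

/-- `id × r` on `X³`. -/
def ybe23 {X : Type*} (r : X × X → X × X) (p : X × X × X) : X × X × X :=
  (p.1, r p.2)

/-- An involutive, non-degenerate set-theoretic solution `r (x, y) = (σ_x (y), γ_y (x))` of the
Yang--Baxter equation on `X`. -/
structure YBESolution (X : Type*) where
  r : X × X → X × X
  involutive : ∀ p, r (r p) = p
  bijective_left : ∀ x, Function.Bijective fun y => (r (x, y)).1
  bijective_right : ∀ y, Function.Bijective fun x => (r (x, y)).2
  braid : ∀ p, ybe12 r (ybe23 r (ybe12 r p)) = ybe23 r (ybe12 r (ybe23 r p))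

namespace YBESolution

variable {X : Type*} (S : YBESolution X)

theorem perm_apply_inv {Y : Type*} (f : Equiv.Perm Y) (y : Y) : f (f⁻¹ y) = y :=
  Equiv.apply_symm_apply f y

theorem perm_inv_apply {Y : Type*} (f : Equiv.Perm Y) (y : Y) : f⁻¹ (f y) = y :=
  Equiv.symm_apply_apply f y

/-- The permutation `σ_x` of `X`. -/
noncomputable def sigma (x : X) : Equiv.Perm X := Equiv.ofBijective _ (S.bijective_left x)

/-- The map `γ_y`. -/
def gamma (y x : X) : X := (S.r (x, y)).2

theorem r_eq (x y : X) : S.r (x, y) = (S.sigma x y, S.gamma y x) := rfl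

theorem sigma_sigma_gamma (x y : X) : S.sigma (S.sigma x y) (S.gamma y x) = x := by
  exact congrArg Prod.fst (S.involutive (x, y))

theorem gamma_gamma_sigma (x y : X) : S.gamma (S.gamma y x) (S.sigma x y) = y := by
  exact congrArg Prod.snd (S.involutive (x, y))

theorem sigma_mul_sigma (x y : X) :
    S.sigma x * S.sigma y = S.sigma (S.sigma x y) * S.sigma (S.gamma y x) := by
  ext z
  have h := congrArg (fun q => q.1) (S.braid (x, y, z))
  exact h.symm

/-- The map `x ↦ σ_x⁻¹ (x)` is bijective: for every `b` there is exactly one `a` with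
`σ_a (b) = a`. -/
theorem existsUnique_sigma (b : X) : ∃! a, S.sigma a b = a := by
  obtain ⟨a, ha⟩ := (S.bijective_right b).2 b
  have ha' : S.gamma b a = b := ha
  refine ⟨a, ?_, fun c hc => ?_⟩
  · apply (S.bijective_right b).1
    change S.gamma b (S.sigma a b) = S.gamma b a
    have h := S.gamma_gamma_sigma a b
    rw [ha'] at h
    rw [h, ha']
  · apply (S.bijective_right b).1
    change S.gamma b c = S.gamma b a
    have hc' : S.sigma c b = c := hc
    have h := S.sigma_sigma_gamma c b
    rw [hc'] at h
    rw [ha']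
    exact (S.sigma c).injective (h.trans hc'.symm)

/-- A group `G` generated by elements `ι x`, for `x ∈ X`, that satisfy the relations
`ι x * ι y = ι (σ_x (y)) * ι (γ_y (x))`, and that acts on `X` with `ι x` acting as `σ_x`. The
structure group and the permutation group of a solution are of this kind. -/
structure GeneratedGroup (G : Type*) [Group G] where
  ρ : G →* Equiv.Perm X
  ι : X → G
  ρ_ι : ∀ x, ρ (ι x) = S.sigma x
  rel : ∀ x y, ι x * ι y = ι (S.sigma x y) * ι (S.gamma y x)
  generates : Subgroup.closure (Set.range ι) = ⊤

namespace GeneratedGroup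

variable {S} {G : Type*} [Group G] (E : S.GeneratedGroup G)

/-- The map `g ↦ g * ι (g⁻¹ x)`; it is going to be `g ↦ g + ι x`. -/
def shiftFun (x : X) (g : G) : G := g * E.ι (E.ρ g⁻¹ x)

theorem shiftFun_bijective (x : X) : Function.Bijective (E.shiftFun x) := by
  have key : ∀ g : G, S.sigma (E.ρ g⁻¹ x) (E.ρ (E.shiftFun x g)⁻¹ x) = E.ρ g⁻¹ x := by
    intro g
    rw [shiftFun, mul_inv_rev, map_mul, map_inv E.ρ (E.ι _), E.ρ_ι, Equiv.Perm.mul_apply,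
      perm_apply_inv]
  constructor
  · intro g h hgh
    have hg := key g
    have hh := key h
    rw [← hgh] at hh
    have e := (S.existsUnique_sigma (E.ρ (E.shiftFun x g)⁻¹ x)).unique hg hh
    have hgh' := hgh
    rw [shiftFun, shiftFun, e] at hgh'
    exact mul_right_cancel hgh'
  · intro h
    obtain ⟨a, ha, -⟩ := S.existsUnique_sigma (E.ρ h⁻¹ x)
    have e : E.ρ (h * (E.ι a)⁻¹)⁻¹ x = a := by
      rw [mul_inv_rev, inv_inv, map_mul, E.ρ_ι, Equiv.Perm.mul_apply]
      exact ha
    exact ⟨h * (E.ι a)⁻¹, by rw [shiftFun, e, inv_mul_cancel_right]⟩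

/-- `shiftFun` as a permutation of `G`. -/
noncomputable def shift (x : X) : Equiv.Perm G := Equiv.ofBijective _ (E.shiftFun_bijective x)

theorem shift_apply (x : X) (g : G) : E.shift x g = g * E.ι (E.ρ g⁻¹ x) := rfl

theorem shift_comm (x y : X) : E.shift x * E.shift y = E.shift y * E.shift x := by
  have key : ∀ a b : X, E.ι a * E.ι ((S.sigma a)⁻¹ b) = E.ι b * E.ι ((S.sigma b)⁻¹ a) := by
    intro a b
    rw [E.rel, perm_apply_inv]
    have h := S.sigma_sigma_gamma a ((S.sigma a)⁻¹ b)
    rw [perm_apply_inv] at h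
    rw [Equiv.Perm.eq_inv_iff_eq.2 h]
  ext g
  simp only [Equiv.Perm.mul_apply, shift_apply, mul_inv_rev, map_mul, map_inv E.ρ (E.ι _), E.ρ_ι]
  rw [mul_assoc, mul_assoc, key]

/-- The group of permutations of `G` generated by the shifts. It is abelian and acts simply
transitively on `G`. -/
def translations : Subgroup (Equiv.Perm G) := Subgroup.closure (Set.range E.shift)

theorem shift_mem (x : X) : E.shift x ∈ E.translations := Subgroup.subset_closure ⟨x, rfl⟩

theorem translations_comm (m n : E.translations) : m * n = n * m := by
  have := Subgroup.isMulCommutative_closure (k := Set.range E.shift) (by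
    rintro _ ⟨x, rfl⟩ _ ⟨y, rfl⟩
    exact E.shift_comm x y)
  exact this.is_comm.comm m n

theorem translations_bijective : Function.Bijective fun n : E.translations => n.1 1 := by
  have surj : ∀ g : G, ∃ n : E.translations, n.1 1 = g := by
    intro g
    have hg : g ∈ Subgroup.closure (Set.range E.ι) := by rw [E.generates]; trivial
    induction hg using Subgroup.closure_induction_right with
    | one => exact ⟨1, rfl⟩
    | mul_right g _ y hy ih =>
      obtain ⟨n, hn⟩ := ih
      obtain ⟨y, rfl⟩ := hy
      refine ⟨⟨E.shift (E.ρ g y), E.shift_mem _⟩ * n, ?_⟩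
      change E.shift (E.ρ g y) (n.1 1) = _
      rw [hn, shift_apply, map_inv, perm_inv_apply]
    | mul_inv_cancel g _ y hy ih =>
      obtain ⟨n, hn⟩ := ih
      obtain ⟨y, rfl⟩ := hy
      refine ⟨⟨E.shift (E.ρ (g * (E.ι y)⁻¹) y), E.shift_mem _⟩⁻¹ * n, ?_⟩
      change (E.shift (E.ρ (g * (E.ι y)⁻¹) y))⁻¹ (n.1 1) = _
      rw [hn, Equiv.Perm.inv_eq_iff_eq, shift_apply, map_inv E.ρ (_ * _),
        perm_inv_apply, inv_mul_cancel_right]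
  refine ⟨fun m n hmn => ?_, surj⟩
  ext g
  obtain ⟨k, rfl⟩ := surj g
  have hm := congrArg (fun z : E.translations => z.1 1) (E.translations_comm m k)
  have hn := congrArg (fun z : E.translations => z.1 1) (E.translations_comm n k)
  have hmn' : m.1 1 = n.1 1 := hmn
  change m.1 (k.1 1) = k.1 (m.1 1) at hm
  change n.1 (k.1 1) = k.1 (n.1 1) at hn
  rw [hm, hn, hmn']

/-- The bijection `n ↦ n (1)` from the group of translations to `G`. -/
noncomputable def orbitEquiv : E.translations ≃ G := Equiv.ofBijective _ E.translations_bijective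

theorem orbitEquiv_apply (n : E.translations) : E.orbitEquiv n = n.1 1 := rfl

/-- The abelian group structure on `G` transported from the group of translations. -/
@[reducible] noncomputable def addCommGroup : AddCommGroup G :=
  letI : CommGroup E.translations :=
    { (inferInstance : Group E.translations) with mul_comm := E.translations_comm }
  Equiv.addCommGroup (E.orbitEquiv.symm.trans Additive.ofMul)

theorem add_eq (m n : E.translations) :
    (letI := E.addCommGroup; E.orbitEquiv m + E.orbitEquiv n) = E.orbitEquiv (m * n) := by
  change E.orbitEquiv (E.orbitEquiv.symm (E.orbitEquiv m) * E.orbitEquiv.symm (E.orbitEquiv n)) = _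
  rw [Equiv.symm_apply_apply, Equiv.symm_apply_apply]

/-- Left multiplications normalize the group of translations. -/
theorem exists_conj (a : G) (n : E.translations) :
    ∃ n' : E.translations, ∀ g, a * n.1 g = n'.1 (a * g) := by
  obtain ⟨n, hn⟩ := n
  change ∃ n' : E.translations, ∀ g, a * n g = n'.1 (a * g)
  induction hn using Subgroup.closure_induction with
  | mem x hx =>
    obtain ⟨x, rfl⟩ := hx
    refine ⟨⟨E.shift (E.ρ a x), E.shift_mem _⟩, fun g => ?_⟩
    change _ = E.shift (E.ρ a x) (a * g)
    rw [shift_apply, shift_apply, mul_inv_rev, map_mul, map_inv E.ρ a, Equiv.Perm.mul_apply,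
      perm_inv_apply, mul_assoc]
  | one => exact ⟨1, fun g => rfl⟩
  | mul m n _ _ hm hn =>
    obtain ⟨m', hm⟩ := hm
    obtain ⟨n', hn⟩ := hn
    refine ⟨m' * n', fun g => ?_⟩
    change a * m (n g) = m'.1 (n'.1 (a * g))
    rw [hm, hn]
  | inv m _ hm =>
    obtain ⟨m', hm⟩ := hm
    refine ⟨m'⁻¹, fun g => ?_⟩
    change a * m⁻¹ g = m'.1⁻¹ (a * g)
    rw [Equiv.Perm.eq_inv_iff_eq, ← hm, perm_apply_inv]

/-- The left brace structure on `G` whose multiplication is that of `G` and whose lambda map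
satisfies `λ_g (ι x) = ι (g x)`. -/
@[reducible] noncomputable def leftBrace : LeftBrace G :=
  { E.addCommGroup, (inferInstance : Group G) with
    brace_eq := by
      intro a b c
      let _ := E.addCommGroup
      change a * (b + c) + a = a * b + a * c
      obtain ⟨n, rfl⟩ := E.orbitEquiv.surjective b
      obtain ⟨m, rfl⟩ := E.orbitEquiv.surjective c
      obtain ⟨n', hn⟩ := E.exists_conj a n
      obtain ⟨m', hm⟩ := E.exists_conj a m
      obtain ⟨k, hk⟩ := E.orbitEquiv.surjective a
      have hk1 : a * 1 = k.1 1 := by rw [mul_one, ← hk]; rfl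
      have e1 : a * E.orbitEquiv n = E.orbitEquiv (n' * k) := by
        rw [orbitEquiv_apply, hn, hk1]; rfl
      have e2 : a * E.orbitEquiv m = E.orbitEquiv (m' * k) := by
        rw [orbitEquiv_apply, hm, hk1]; rfl
      have e3 : a * E.orbitEquiv (n * m) = E.orbitEquiv (n' * (m' * k)) := by
        rw [orbitEquiv_apply]
        change a * n.1 (m.1 1) = _
        rw [hn, hm, hk1]; rfl
      rw [E.add_eq n m, e1, e2, e3]
      have e4 : E.orbitEquiv (n' * (m' * k)) + a = E.orbitEquiv (n' * (m' * k) * k) := by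
        rw [← hk]
        exact E.add_eq _ _
      rw [e4, E.add_eq, mul_assoc, mul_assoc, mul_assoc, E.translations_comm k (m' * k),
        mul_assoc] }

theorem add_ι (g : G) (x : X) :
    (letI := E.leftBrace; g + E.ι x) = E.shift x g := by
  obtain ⟨n, rfl⟩ := E.orbitEquiv.surjective g
  have h : E.ι x = E.orbitEquiv ⟨E.shift x, E.shift_mem x⟩ := by
    rw [orbitEquiv_apply]
    change _ = E.shift x 1
    rw [shift_apply, inv_one, map_one, one_mul, Equiv.Perm.one_apply]
  rw [h]
  refine (E.add_eq n _).trans ?_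
  rw [E.translations_comm]
  rfl

theorem lam_ι (g : G) (x : X) :
    (letI := E.leftBrace; LeftBrace.lam g (E.ι x)) = E.ι (E.ρ g x) := by
  let _ := E.leftBrace
  have h := E.add_ι g (E.ρ g x)
  rw [shift_apply, map_inv, perm_inv_apply] at h
  refine add_left_cancel (a := g) ?_
  rw [h]
  exact LeftBrace.add_lam g (E.ι x)

/-- An equivariant homomorphism between two such groups is additive. -/
theorem map_add {G' : Type*} [Group G'] (E' : S.GeneratedGroup G') (φ : G →* G')
    (hι : ∀ x, φ (E.ι x) = E'.ι x) (g h : G) :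
    φ (letI := E.leftBrace; g + h) = (letI := E'.leftBrace; φ g + φ h) := by
  have hρ : ∀ g, E'.ρ (φ g) = E.ρ g := by
    intro g
    have hg : g ∈ Subgroup.closure (Set.range E.ι) := by rw [E.generates]; trivial
    induction hg using Subgroup.closure_induction with
    | mem x hx =>
      obtain ⟨x, rfl⟩ := hx
      rw [hι, E.ρ_ι, E'.ρ_ι]
    | one => simp
    | mul a b _ _ ha hb => rw [map_mul, map_mul, map_mul, ha, hb]
    | inv a _ ha => rw [map_inv, map_inv, map_inv, ha]
  have hs : ∀ x g, φ (E.shift x g) = E'.shift x (φ g) := by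
    intro x g
    rw [shift_apply, shift_apply, map_mul, hι, ← map_inv, hρ]
  have hn : ∀ n : E.translations, ∃ n' : E'.translations, ∀ g, φ (n.1 g) = n'.1 (φ g) := by
    rintro ⟨n, hn⟩
    change ∃ n' : E'.translations, ∀ g, φ (n g) = n'.1 (φ g)
    induction hn using Subgroup.closure_induction with
    | mem x hx =>
      obtain ⟨x, rfl⟩ := hx
      exact ⟨⟨E'.shift x, E'.shift_mem x⟩, hs x⟩
    | one => exact ⟨1, fun g => rfl⟩
    | mul m n _ _ hm hn =>
      obtain ⟨m', hm⟩ := hm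
      obtain ⟨n', hn⟩ := hn
      refine ⟨m' * n', fun g => ?_⟩
      change φ (m (n g)) = m'.1 (n'.1 (φ g))
      rw [hm, hn]
    | inv m _ hm =>
      obtain ⟨m', hm⟩ := hm
      refine ⟨m'⁻¹, fun g => ?_⟩
      change φ (m⁻¹ g) = m'.1⁻¹ (φ g)
      rw [Equiv.Perm.eq_inv_iff_eq, ← hm, perm_apply_inv]
  obtain ⟨m, rfl⟩ := E.orbitEquiv.surjective g
  obtain ⟨n, rfl⟩ := E.orbitEquiv.surjective h
  obtain ⟨m', hm⟩ := hn m
  obtain ⟨n', hn⟩ := hn n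
  have em : φ (E.orbitEquiv m) = E'.orbitEquiv m' := by
    rw [orbitEquiv_apply, hm, map_one]; rfl
  have en : φ (E.orbitEquiv n) = E'.orbitEquiv n' := by
    rw [orbitEquiv_apply, hn, map_one]; rfl
  rw [em, en]
  refine (congrArg φ (E.add_eq m n)).trans (Eq.trans ?_ (E'.add_eq m' n').symm)
  rw [orbitEquiv_apply]
  change φ (m.1 (n.1 1)) = m'.1 (n'.1 1)
  rw [hm, hn, map_one]

end GeneratedGroup

/-- The relations `x y = σ_x (y) γ_y (x)` of the structure group. -/
def structureRels : Set (FreeGroup X) :=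
  {w | ∃ x y, w = FreeGroup.of x * FreeGroup.of y *
    (FreeGroup.of (S.sigma x y) * FreeGroup.of (S.gamma y x))⁻¹}

/-- The structure group `G(X, r)`. -/
def StructureGroup : Type _ := PresentedGroup S.structureRels

instance : Group S.StructureGroup := inferInstanceAs (Group (PresentedGroup S.structureRels))

/-- The permutation group `𝒢(X, r)`, the subgroup of `Sym X` generated by the `σ_x`. -/
def PermGroup : Type _ := Subgroup.closure (Set.range S.sigma)

noncomputable instance permGroupGroup : Group S.PermGroup :=
  inferInstanceAs (Group (Subgroup.closure (Set.range S.sigma)))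

/-- The canonical generators of the structure group. -/
def StructureGroup.of (x : X) : S.StructureGroup := PresentedGroup.of x

/-- The element `σ_x` of the permutation group. -/
noncomputable def PermGroup.of (x : X) : S.PermGroup :=
  ⟨S.sigma x, Subgroup.subset_closure ⟨x, rfl⟩⟩

/-- The canonical homomorphism `φ : G(X, r) → 𝒢(X, r)`, `x ↦ σ_x`. -/
noncomputable def toPermGroup : S.StructureGroup →* S.PermGroup :=
  PresentedGroup.toGroup (f := PermGroup.of S) (by
    rintro w ⟨x, y, rfl⟩
    simp only [map_mul, map_inv, FreeGroup.lift_apply_of]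
    rw [mul_inv_eq_one]
    exact Subtype.ext (S.sigma_mul_sigma x y))

theorem toPermGroup_of (x : X) : S.toPermGroup (StructureGroup.of S x) = PermGroup.of S x :=
  PresentedGroup.toGroup.of _

/-- The permutation group with its action on `X`. -/
noncomputable def permGroupGenerated : S.GeneratedGroup S.PermGroup where
  ρ := (Subgroup.closure (Set.range S.sigma)).subtype
  ι := PermGroup.of S
  ρ_ι _ := rfl
  rel x y := Subtype.ext (S.sigma_mul_sigma x y)
  generates := by
    have h := Subgroup.closure_closure_coe_preimage (k := Set.range S.sigma)
    have e : Set.range (PermGroup.of S) =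
        ((↑) : Subgroup.closure (Set.range S.sigma) → Equiv.Perm X) ⁻¹' Set.range S.sigma := by
      ext g
      constructor
      · rintro ⟨x, rfl⟩
        exact ⟨x, rfl⟩
      · rintro ⟨x, hx⟩
        exact ⟨x, Subtype.ext hx⟩
    exact (congrArg Subgroup.closure e).trans h

/-- The structure group with its action on `X` through `φ`. -/
noncomputable def structureGroupGenerated : S.GeneratedGroup S.StructureGroup where
  ρ := (S.permGroupGenerated.ρ).comp S.toPermGroup
  ι := StructureGroup.of S
  ρ_ι x := by
    rw [MonoidHom.comp_apply, toPermGroup_of]; rfl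
  rel x y := by
    rw [← mul_inv_eq_one]
    exact PresentedGroup.one_of_mem (rels := S.structureRels) ⟨x, y, rfl⟩
  generates := PresentedGroup.closure_range_of _

/-- The natural left brace structure on the structure group, with `λ_x (y) = σ_x (y)` for
`x, y ∈ X`. -/
noncomputable instance : LeftBrace S.StructureGroup := S.structureGroupGenerated.leftBrace

/-- The natural left brace structure on the permutation group: the only one for which
`φ : G(X, r) → 𝒢(X, r)` is a homomorphism of left braces. -/
noncomputable instance : LeftBrace S.PermGroup := S.permGroupGenerated.leftBrace

theorem StructureGroup.lam_of (x y : X) :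
    LeftBrace.lam (StructureGroup.of S x) (StructureGroup.of S y) =
      StructureGroup.of S (S.sigma x y) := by
  have h := S.structureGroupGenerated.lam_ι (StructureGroup.of S x) y
  rwa [show S.structureGroupGenerated.ρ (StructureGroup.of S x) = S.sigma x from
    S.structureGroupGenerated.ρ_ι x] at h

theorem toPermGroup_mul (g h : S.StructureGroup) :
    S.toPermGroup (g * h) = S.toPermGroup g * S.toPermGroup h := _root_.map_mul _ g h

theorem toPermGroup_add (g h : S.StructureGroup) :
    S.toPermGroup (g + h) = S.toPermGroup g + S.toPermGroup h :=
  S.structureGroupGenerated.map_add S.permGroupGenerated S.toPermGroup S.toPermGroup_of g h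

/-- The restriction of a solution to a subset that is stable under all `σ_x`, `γ_y` and their
inverses. -/
def restrict (Y : Set X) (hσ : ∀ x y, (S.r (x, y)).1 ∈ Y ↔ y ∈ Y)
    (hγ : ∀ x y, (S.r (x, y)).2 ∈ Y ↔ x ∈ Y) : YBESolution Y where
  r p := (⟨(S.r (p.1, p.2)).1, (hσ _ _).2 p.2.2⟩, ⟨(S.r (p.1, p.2)).2, (hγ _ _).2 p.1.2⟩)
  involutive p := by
    have h := S.involutive (p.1.1, p.2.1)
    exact Prod.ext (Subtype.ext (congrArg Prod.fst h)) (Subtype.ext (congrArg Prod.snd h))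
  bijective_left x := by
    constructor
    · intro y z h
      exact Subtype.ext ((S.bijective_left x.1).1 (congrArg Subtype.val h))
    · intro y
      obtain ⟨z, hz⟩ := (S.bijective_left x.1).2 y.1
      have hz' : (S.r (x.1, z)).1 = y.1 := hz
      exact ⟨⟨z, (hσ x.1 z).1 (hz' ▸ y.2)⟩, Subtype.ext hz⟩
  bijective_right y := by
    constructor
    · intro x z h
      exact Subtype.ext ((S.bijective_right y.1).1 (congrArg Subtype.val h))
    · intro x
      obtain ⟨z, hz⟩ := (S.bijective_right y.1).2 x.1
      have hz' : (S.r (z, y.1)).2 = x.1 := hz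
      exact ⟨⟨z, (hγ z y.1).1 (hz' ▸ x.2)⟩, Subtype.ext hz⟩
  braid p := by
    have h := S.braid (p.1.1, p.2.1.1, p.2.2.1)
    have h1 := congrArg (fun q => q.1) h
    have h2 := congrArg (fun q => q.2.1) h
    have h3 := congrArg (fun q => q.2.2) h
    exact Prod.ext (Subtype.ext h1) (Prod.ext (Subtype.ext h2) (Subtype.ext h3))

end YBESolution

namespace LeftBrace

variable (B : Type*) [LeftBrace B]

/-- The map `γ_b (a) = λ_{λ_a (b)}⁻¹ (a)`. -/
def gam (b a : B) : B := (lam (lam a b)).symm a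

variable {B}

theorem lam_mul_gam (a b : B) : lam a b * gam B b a = a * b := by
  rw [gam, gam_eq, mul_inv_cancel_left]

theorem gam_mul (a b c : B) : gam B c (gam B b a) = gam B (b * c) a := by
  have h1 : lam a (b * c) = lam a b * lam (gam B b a) c := by
    rw [← add_lam b c, map_add, ← add_lam (lam a b), ← lam_mul (lam a b), lam_mul_gam, lam_mul]
  have h2 : gam B c (gam B b a) = (lam (gam B b a) c)⁻¹ * (gam B b a * c) := gam_eq _ _
  have h3 : gam B (b * c) a = (lam a (b * c))⁻¹ * (a * (b * c)) := gam_eq _ _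
  rw [h2, h3, h1, mul_inv_rev, mul_assoc, ← mul_assoc a b c, ← lam_mul_gam a b, mul_assoc,
    inv_mul_cancel_left]

theorem gam_one (a : B) : gam B 1 a = a := by
  have h : gam B 1 a = (lam a 1)⁻¹ * (a * 1) := gam_eq _ _
  rw [h, mul_one, one_eq_zero, map_zero, ← one_eq_zero, inv_one, one_mul]

variable (B)

/-- The solution `r_B (a, b) = (λ_a (b), λ_{λ_a (b)}⁻¹ (a))` associated to a left brace. -/
def solution : YBESolution B where
  r p := (lam p.1 p.2, (lam (lam p.1 p.2)).symm p.1)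
  involutive p := by
    obtain ⟨a, b⟩ := p
    have h : lam (lam a b) ((lam (lam a b)).symm a) = a := AddEquiv.apply_symm_apply _ _
    refine Prod.ext h ?_
    change (lam (lam (lam a b) ((lam (lam a b)).symm a))).symm (lam a b) = b
    rw [h, AddEquiv.symm_apply_apply]
  bijective_left x := (lam x).bijective
  bijective_right y := by
    change Function.Bijective fun x => gam B y x
    refine Function.bijective_iff_has_inverse.2 ⟨fun x => gam B y⁻¹ x, fun x => ?_, fun x => ?_⟩
    · change gam B y⁻¹ (gam B y x) = x
      rw [gam_mul, mul_inv_cancel, gam_one]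
    · change gam B y (gam B y⁻¹ x) = x
      rw [gam_mul, inv_mul_cancel, gam_one]
  braid p := by
    obtain ⟨a, b, c⟩ := p
    change (lam (lam a b) (lam (gam B b a) c), gam B (lam (gam B b a) c) (lam a b),
        gam B c (gam B b a)) =
      (lam a (lam b c), lam (gam B (lam b c) a) (gam B c b), gam B (gam B c b) (gam B (lam b c) a))
    have e1 : lam (lam a b) (lam (gam B b a) c) = lam a (lam b c) := by
      rw [← lam_mul, lam_mul_gam, lam_mul]
    have e3 : gam B c (gam B b a) = gam B (gam B c b) (gam B (lam b c) a) := by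
      rw [gam_mul, gam_mul, lam_mul_gam]
    have e2 : gam B (lam (gam B b a) c) (lam a b) = lam (gam B (lam b c) a) (gam B c b) := by
      have l : lam (lam a b) (lam (gam B b a) c) * gam B (lam (gam B b a) c) (lam a b) *
          gam B c (gam B b a) = a * b * c := by
        rw [lam_mul_gam, mul_assoc, lam_mul_gam, ← mul_assoc, lam_mul_gam]
      have r : lam a (lam b c) * lam (gam B (lam b c) a) (gam B c b) *
          gam B (gam B c b) (gam B (lam b c) a) = a * b * c := by
        rw [mul_assoc, lam_mul_gam, ← mul_assoc, lam_mul_gam, mul_assoc, lam_mul_gam, ← mul_assoc]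
      rw [← r, e1, e3] at l
      exact mul_left_cancel (mul_right_cancel l)
    rw [e1, e2, e3]

end LeftBrace

/-! ### Asymmetric products -/

/-- The data of an asymmetric product of the trivial brace on an abelian group `H` by a left brace
`S`: an action `α` of the multiplicative group of `S` on `H` and a symmetric bi-additive map
`b : H × H → S` with `λ_s (b (f, h)) = b (α_s f, α_s h)`. -/
structure AsymData (H S : Type*) [AddCommGroup H] [LeftBrace S] where
  α : S → H ≃+ H
  α_mul : ∀ s u h, α (s * u) h = α s (α u h)
  b : H → H → S
  b_add : ∀ f g h, b (f + g) h = b f h + b g h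
  b_symm : ∀ f h, b f h = b h f
  lam_b : ∀ s f h, LeftBrace.lam s (b f h) = b (α s f) (α s h)

/-- The underlying set `H × S` of the asymmetric product. -/
@[ext]
structure AsymData.Product {H S : Type*} [AddCommGroup H] [LeftBrace S] (D : AsymData H S) where
  fst : H
  snd : S

namespace AsymData

variable {H S : Type*} [AddCommGroup H] [LeftBrace S] (D : AsymData H S)

theorem add_b (f g h : H) : D.b f (g + h) = D.b f g + D.b f h := by
  rw [D.b_symm, D.b_add, D.b_symm g, D.b_symm h]

theorem zero_b (h : H) : D.b 0 h = 0 := by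
  have e := D.b_add 0 0 h
  rw [add_zero] at e
  exact left_eq_add.1 e

theorem b_zero (h : H) : D.b h 0 = 0 := by rw [D.b_symm, D.zero_b]

theorem neg_b (f h : H) : D.b (-f) h = -D.b f h := by
  have e := D.b_add (-f) f h
  rw [neg_add_cancel, zero_b] at e
  exact eq_neg_of_add_eq_zero_left e.symm

theorem α_one (h : H) : D.α 1 h = h := by
  apply (D.α 1).injective
  rw [← D.α_mul, one_mul]

theorem α_inv_α (s : S) (h : H) : D.α s⁻¹ (D.α s h) = h := by
  rw [← D.α_mul, inv_mul_cancel, α_one]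

namespace Product

variable {D}

instance : Add D.Product := ⟨fun p q => ⟨p.fst + q.fst, p.snd + q.snd + D.b p.fst q.fst⟩⟩
instance : Zero D.Product := ⟨⟨0, 0⟩⟩
instance : Neg D.Product := ⟨fun p => ⟨-p.fst, -p.snd + D.b p.fst p.fst⟩⟩
instance : Mul D.Product := ⟨fun p q => ⟨p.fst + D.α p.snd q.fst, p.snd * q.snd⟩⟩
instance : One D.Product := ⟨⟨0, 1⟩⟩
instance : Inv D.Product := ⟨fun p => ⟨-D.α p.snd⁻¹ p.fst, p.snd⁻¹⟩⟩

@[simp] theorem add_fst (p q : D.Product) : (p + q).fst = p.fst + q.fst := rfl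
@[simp] theorem add_snd (p q : D.Product) :
    (p + q).snd = p.snd + q.snd + D.b p.fst q.fst := rfl
@[simp] theorem zero_fst : (0 : D.Product).fst = 0 := rfl
@[simp] theorem zero_snd : (0 : D.Product).snd = 0 := rfl
@[simp] theorem neg_fst (p : D.Product) : (-p).fst = -p.fst := rfl
@[simp] theorem neg_snd (p : D.Product) : (-p).snd = -p.snd + D.b p.fst p.fst := rfl
@[simp] theorem mul_fst (p q : D.Product) : (p * q).fst = p.fst + D.α p.snd q.fst := rfl
@[simp] theorem mul_snd (p q : D.Product) : (p * q).snd = p.snd * q.snd := rfl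
@[simp] theorem one_fst : (1 : D.Product).fst = 0 := rfl
@[simp] theorem one_snd : (1 : D.Product).snd = 1 := rfl
@[simp] theorem inv_fst (p : D.Product) : (p⁻¹).fst = -D.α p.snd⁻¹ p.fst := rfl
@[simp] theorem inv_snd (p : D.Product) : (p⁻¹).snd = p.snd⁻¹ := rfl

instance : AddCommGroup D.Product where
  add_assoc p q w := by
    ext
    · simp [add_assoc]
    · simp only [add_snd, add_fst, D.b_add, D.add_b]; abel
  zero_add p := by ext <;> simp [D.zero_b]
  add_zero p := by ext <;> simp [D.b_zero]
  nsmul := nsmulRec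
  zsmul := zsmulRec
  neg_add_cancel p := by
    ext
    · simp
    · simp only [add_snd, neg_snd, neg_fst, D.neg_b, zero_snd]; abel
  add_comm p q := by
    ext
    · simp [add_comm]
    · simp only [add_snd]; rw [D.b_symm, add_comm p.snd]

instance : Group D.Product :=
  Group.ofLeftAxioms
    (by
      intro p q w
      ext
      · simp [D.α_mul, add_assoc]
      · simp [mul_assoc])
    (by
      intro p
      ext <;> simp [D.α_one])
    (by
      intro p
      ext <;> simp)

/-- The asymmetric product `H ⋊∘ S`: its multiplicative group is the semidirect product
`H ⋊_α S`, and `(f, s) + (h, u) = (f + h, s + u + b (f, h))`. -/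
instance : LeftBrace D.Product where
  brace_eq p q w := by
    ext
    · simp only [add_fst, mul_fst, map_add]; abel
    · simp only [add_snd, mul_snd, add_fst, mul_fst, map_add, D.b_add, D.add_b]
      have h := LeftBrace.add_lam p.snd (D.b q.fst w.fst)
      rw [LeftBrace.mul_add', LeftBrace.mul_add', ← h, D.lam_b, D.b_symm p.fst (D.α p.snd w.fst)]
      abel

end Product

end AsymData

/-! ### The construction -/

/-- The underlying set `A × T` of `A₁ = A ⋊ T`, where `T = ⟨t⟩`. Automorphisms of the abelian group
`A` are written as `ℤ`-linear automorphisms. -/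
@[ext]
structure SemiBrace {A : Type*} [AddCommGroup A] (t : A ≃ₗ[ℤ] A) where
  fst : A
  snd : Subgroup.zpowers t

namespace SemiBrace

variable {A : Type*} [AddCommGroup A] {t : A ≃ₗ[ℤ] A}

instance : Add (SemiBrace t) := ⟨fun p q => ⟨p.fst + q.fst, p.snd * q.snd⟩⟩
instance : Zero (SemiBrace t) := ⟨⟨0, 1⟩⟩
instance : Neg (SemiBrace t) := ⟨fun p => ⟨-p.fst, p.snd⁻¹⟩⟩
instance : Mul (SemiBrace t) := ⟨fun p q => ⟨p.fst + p.snd.1 q.fst, p.snd * q.snd⟩⟩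
instance : One (SemiBrace t) := ⟨⟨0, 1⟩⟩
instance : Inv (SemiBrace t) := ⟨fun p => ⟨-p.snd.1⁻¹ p.fst, p.snd⁻¹⟩⟩

@[simp] theorem add_fst (p q : SemiBrace t) : (p + q).fst = p.fst + q.fst := rfl
@[simp] theorem add_snd (p q : SemiBrace t) : (p + q).snd = p.snd * q.snd := rfl
@[simp] theorem zero_fst : (0 : SemiBrace t).fst = 0 := rfl
@[simp] theorem zero_snd : (0 : SemiBrace t).snd = 1 := rfl
@[simp] theorem neg_fst (p : SemiBrace t) : (-p).fst = -p.fst := rfl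
@[simp] theorem neg_snd (p : SemiBrace t) : (-p).snd = p.snd⁻¹ := rfl
@[simp] theorem mul_fst (p q : SemiBrace t) : (p * q).fst = p.fst + p.snd.1 q.fst := rfl
@[simp] theorem mul_snd (p q : SemiBrace t) : (p * q).snd = p.snd * q.snd := rfl
@[simp] theorem one_fst : (1 : SemiBrace t).fst = 0 := rfl
@[simp] theorem one_snd : (1 : SemiBrace t).snd = 1 := rfl
@[simp] theorem inv_fst (p : SemiBrace t) : (p⁻¹).fst = -p.snd.1⁻¹ p.fst := rfl
@[simp] theorem inv_snd (p : SemiBrace t) : (p⁻¹).snd = p.snd⁻¹ := rfl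

theorem zpowers_comm (u v : Subgroup.zpowers t) : u * v = v * u := by
  obtain ⟨_, z, rfl⟩ := u
  obtain ⟨_, w, rfl⟩ := v
  exact Subtype.ext (zpow_mul_comm t z w)

instance : AddCommGroup (SemiBrace t) where
  add_assoc p q w := by ext1 <;> simp [add_assoc, mul_assoc]
  zero_add p := by ext1 <;> simp
  add_zero p := by ext1 <;> simp
  nsmul := nsmulRec
  zsmul := zsmulRec
  neg_add_cancel p := by ext1 <;> simp
  add_comm p q := by
    ext1
    · exact add_comm _ _
    · exact zpowers_comm _ _

instance : Group (SemiBrace t) :=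
  Group.ofLeftAxioms
    (by
      intro p q w
      ext1
      · simp only [mul_fst, mul_snd, map_add, add_assoc]
        rfl
      · simp [mul_assoc])
    (by
      intro p
      ext1
      · simp only [mul_fst, one_fst, one_snd, zero_add]
        rfl
      · simp)
    (by
      intro p
      ext1
      · simp only [mul_fst, inv_fst, inv_snd, one_fst]
        exact neg_add_cancel _
      · simp)

/-- The left brace `A₁ = A ⋊ T`, the semidirect product of the trivial left braces on `A` and `T`:
`(a, u) + (c, v) = (a + c, u v)` and `(a, u) (c, v) = (a + u c, u v)`. -/
instance : LeftBrace (SemiBrace t) where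
  brace_eq p q w := by
    ext1
    · simp only [add_fst, mul_fst, map_add]; abel
    · simp only [add_snd, mul_snd]
      rw [mul_assoc, mul_assoc, mul_assoc, zpowers_comm p.snd w.snd]

theorem lam_eq (p : SemiBrace t) (a : A) :
    LeftBrace.lam p ⟨a, 1⟩ = ⟨p.snd.1 a, 1⟩ := by
  rw [LeftBrace.lam_apply]
  ext1
  · simp
  · simp

end SemiBrace

/-- The `ℤ/n`-module structure of an abelian group of exponent `n`. -/
@[reducible] noncomputable def exponentModule (A : Type*) [AddCommGroup A] :
    Module (ZMod (AddMonoid.exponent A)) A :=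
  AddCommGroup.zmodModule AddMonoid.exponent_nsmul_eq_zero

/-- An abelian group `A`, an automorphism `t` of `A` such that `t - id` is an automorphism as well,
and a family `(j_a)` of elements of `A` with `j_a = j_{-a}` and
`j_{t^z (a)} = t^z (j_a) - (t^z - id) (j_0)` for all `z ∈ ℤ`. -/
structure JFamily (A : Type*) [AddCommGroup A] where
  t : A ≃ₗ[ℤ] A
  sub_bijective : Function.Bijective fun a => t a - a
  j : A → A
  j_neg : ∀ a, j a = j (-a)
  j_zpow : ∀ (a : A) (z : ℤ), j ((t ^ z) a) = (t ^ z) (j a) - ((t ^ z) (j 0) - j 0)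

namespace JFamily

variable {A : Type*} [AddCommGroup A] (D : JFamily A)

/-- The automorphism `t - id`. -/
noncomputable def tSub : A ≃ₗ[ℤ] A :=
  LinearEquiv.ofBijective (D.t.toLinearMap - LinearMap.id) D.sub_bijective

theorem tSub_apply (a : A) : D.tSub a = D.t a - a := rfl

/-- The group `T` generated by `t`. -/
abbrev T : Subgroup (A ≃ₗ[ℤ] A) := Subgroup.zpowers D.t

theorem t_comm (u : D.T) (a : A) : D.t (u.1 a) = u.1 (D.t a) := by
  have h := SemiBrace.zpowers_comm ⟨D.t, Subgroup.mem_zpowers D.t⟩ u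
  have h' := congrArg Subtype.val h
  exact congrArg (fun f : A ≃ₗ[ℤ] A => f a) h'

theorem tSub_symm_comm (u : D.T) (a : A) : D.tSub.symm (u.1 a) = u.1 (D.tSub.symm a) := by
  rw [LinearEquiv.symm_apply_eq, tSub_apply, t_comm, ← map_sub, ← tSub_apply,
    LinearEquiv.apply_symm_apply]

/-- The element `(t - id)⁻² (u t - t) (j_0)`, for `u ∈ T`. -/
noncomputable def shift (u : D.T) : A :=
  D.tSub.symm (D.tSub.symm (u.1 (D.t (D.j 0)) - D.t (D.j 0)))

theorem shift_mul (u v : D.T) : D.shift (u * v) = D.shift u + u.1 (D.shift v) := by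
  have h : (u * v).1 (D.t (D.j 0)) - D.t (D.j 0) =
      (u.1 (D.t (D.j 0)) - D.t (D.j 0)) + u.1 (v.1 (D.t (D.j 0)) - D.t (D.j 0)) := by
    rw [map_sub]
    change u.1 (v.1 (D.t (D.j 0))) - _ = _
    abel
  rw [shift, h, map_add, map_add, tSub_symm_comm, tSub_symm_comm]
  rfl

/-- The left brace `A₁ = A ⋊ T`. -/
abbrev A₁ : Type _ := SemiBrace D.t

/-- The bijection `g_{(a, u)} (x) = u⁻¹ (x - a - (t - id)⁻² (u t - t) (j_0))` of `A`, for
`u = t^z ∈ T`. -/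
noncomputable def g (p : D.A₁) : Equiv.Perm A where
  toFun x := p.snd.1⁻¹ (x - p.fst - D.shift p.snd)
  invFun x := p.snd.1 x + p.fst + D.shift p.snd
  left_inv x := by
    have h : ∀ y, p.snd.1 (p.snd.1⁻¹ y) = y := fun y => LinearEquiv.apply_symm_apply p.snd.1 y
    change p.snd.1 (p.snd.1⁻¹ (x - p.fst - D.shift p.snd)) + p.fst + D.shift p.snd = x
    rw [h]; abel
  right_inv x := by
    have h : ∀ y, p.snd.1⁻¹ (p.snd.1 y) = y := fun y => LinearEquiv.symm_apply_apply p.snd.1 y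
    change p.snd.1⁻¹ (p.snd.1 x + p.fst + D.shift p.snd - p.fst - D.shift p.snd) = x
    have e : p.snd.1 x + p.fst + D.shift p.snd - p.fst - D.shift p.snd = p.snd.1 x := by abel
    rw [e, h]

theorem g_symm_apply (p : D.A₁) (x : A) :
    (D.g p).symm x = p.snd.1 x + p.fst + D.shift p.snd := rfl

theorem g_symm_mul (p q : D.A₁) (x : A) : (D.g (p * q)).symm x = (D.g p).symm ((D.g q).symm x) := by
  simp only [g_symm_apply, SemiBrace.mul_fst, SemiBrace.mul_snd, shift_mul, map_add]
  change p.snd.1 (q.snd.1 x) + _ + _ = _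
  abel

/-- The group `H'` of finitely supported functions `A → ℤ/n`, where `n` is the exponent of `A`. -/
abbrev H' (_D : JFamily A) : Type _ := A →₀ ZMod (AddMonoid.exponent A)

/-- The action `α' (p) (f) = f ∘ g_p` of `A₁` on `H'`. -/
noncomputable def α' (p : D.A₁) : D.H' ≃+ D.H' := Finsupp.domCongr (D.g p).symm

theorem α'_apply (p : D.A₁) (f : D.H') (x : A) : D.α' p f x = f (D.g p x) := rfl

theorem α'_mul (p q : D.A₁) (f : D.H') : D.α' (p * q) f = D.α' p (D.α' q f) := by
  ext x
  rw [α'_apply, α'_apply, α'_apply]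
  congr 1
  rw [← Equiv.eq_symm_apply, g_symm_mul, Equiv.symm_apply_apply, Equiv.symm_apply_apply]

attribute [local instance] exponentModule in
/-- The sum `∑_{x, y ∈ A} f (x) h (y) t (j_{x - y} - j_0)`. -/
noncomputable def pairing (f h : D.H') : A :=
  f.sum fun x m => h.sum fun y k => (m * k) • D.t (D.j (x - y) - D.j 0)

attribute [local instance] exponentModule in
theorem pairing_add (f f' h : D.H') : D.pairing (f + f') h = D.pairing f h + D.pairing f' h := by
  classical
  refine Finsupp.sum_add_index' (fun x => ?_) (fun x m m' => ?_)
  · simp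
  · rw [← Finsupp.sum_add]
    simp only [add_mul, add_smul]

attribute [local instance] exponentModule in
theorem pairing_symm (f h : D.H') : D.pairing f h = D.pairing h f := by
  rw [pairing, pairing, Finsupp.sum_comm]
  refine Finsupp.sum_congr fun y _ => Finsupp.sum_congr fun x _ => ?_
  rw [mul_comm, D.j_neg, neg_sub]

theorem t_j (u : D.T) (a : A) : D.j (u.1 a) - D.j 0 = u.1 (D.j a - D.j 0) := by
  obtain ⟨_, z, rfl⟩ := u
  change D.j ((D.t ^ z) a) - D.j 0 = (D.t ^ z) (D.j a - D.j 0)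
  rw [D.j_zpow, map_sub]; abel

attribute [local instance] exponentModule in
theorem pairing_α' (p : D.A₁) (f h : D.H') :
    D.pairing (D.α' p f) (D.α' p h) = p.snd.1 (D.pairing f h) := by
  have es : ∀ (f : D.H') (F : A → ZMod (AddMonoid.exponent A) → A),
      (D.α' p f).sum F = f.sum fun x m => F ((D.g p).symm x) m := by
    intro f F
    exact Finsupp.sum_equivMapDomain (D.g p).symm f F
  rw [pairing, es, pairing, map_finsuppSum]
  refine Finsupp.sum_congr fun x _ => ?_
  rw [es, map_finsuppSum]
  refine Finsupp.sum_congr fun y _ => ?_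
  rw [ZMod.map_smul p.snd.1, ← t_comm, ← t_j, g_symm_apply, g_symm_apply, map_sub p.snd.1,
    add_sub_add_right_eq_sub, add_sub_add_right_eq_sub]

/-- The bilinear form `b' (f, h) = (∑_{x, y ∈ A} f (x) h (y) t (j_{x - y} - j_0), id)`. -/
noncomputable def b' (f h : D.H') : D.A₁ := ⟨D.pairing f h, 1⟩

/-- The data `(α', b')` of the asymmetric product. -/
noncomputable def asymData : AsymData D.H' D.A₁ where
  α := D.α'
  α_mul := D.α'_mul
  b := D.b'
  b_add f f' h := by
    refine SemiBrace.ext (D.pairing_add f f' h) ?_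
    exact (mul_one _).symm
  b_symm f h := SemiBrace.ext (D.pairing_symm f h) rfl
  lam_b p f h := by
    rw [b', SemiBrace.lam_eq, b', pairing_α']

/-- The left brace `B' = H' ⋊∘ A₁`. -/
abbrev B' : Type _ := D.asymData.Product

/-- The element `x'_{(a, c)} = (e'_a, (c - t (t - id)⁻¹ (j_0), t))` of `B'`, where `e'_a` is the
indicator function of `a`. -/
noncomputable def x' (a c : A) : D.B' :=
  ⟨Finsupp.single a 1, ⟨c - D.t (D.tSub.symm (D.j 0)), ⟨D.t, Subgroup.mem_zpowers D.t⟩⟩⟩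

/-- The set `X' = {x'_{(a, c)} | a, c ∈ A}`. -/
def X' : Set D.B' := {x | ∃ a c : A, x = D.x' a c}

theorem mem_X'_iff (q : D.B') :
    q ∈ D.X' ↔ (∃ a, q.fst = Finsupp.single a 1) ∧
      q.snd.snd = ⟨D.t, Subgroup.mem_zpowers D.t⟩ := by
  constructor
  · rintro ⟨a, c, rfl⟩
    exact ⟨⟨a, rfl⟩, rfl⟩
  · rintro ⟨⟨a, ha⟩, hq⟩
    refine ⟨a, q.snd.fst + D.t (D.tSub.symm (D.j 0)), ?_⟩
    refine AsymData.Product.ext ha (SemiBrace.ext ?_ hq)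
    exact (add_sub_cancel_right _ _).symm

theorem lam_mem_X' (p q : D.B') (hq : q ∈ D.X') : LeftBrace.lam p q ∈ D.X' := by
  rw [mem_X'_iff] at hq ⊢
  obtain ⟨⟨a, ha⟩, hq⟩ := hq
  rw [LeftBrace.lam_apply]
  refine ⟨⟨(D.g p.snd).symm a, ?_⟩, ?_⟩
  · rw [AsymData.Product.add_fst, AsymData.Product.neg_fst, AsymData.Product.mul_fst,
      neg_add_cancel_left, ha]
    exact Finsupp.equivMapDomain_single _ _ _
  · rw [← hq]
    change p.snd.snd⁻¹ * 1 * (p.snd.snd * q.snd.snd) * 1 = q.snd.snd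
    group

theorem lam_mem_X'_iff (p q : D.B') : LeftBrace.lam p q ∈ D.X' ↔ q ∈ D.X' := by
  refine ⟨fun h => ?_, D.lam_mem_X' p q⟩
  have := D.lam_mem_X' p⁻¹ _ h
  rwa [LeftBrace.lam_inv_lam] at this

/-- The solution `(X', r')`, the restriction to `X'` of the solution associated to `B'`. -/
noncomputable def solution : YBESolution D.X' :=
  (LeftBrace.solution D.B').restrict D.X' (fun p q => D.lam_mem_X'_iff p q)
    (fun p q => D.lam_mem_X'_iff (LeftBrace.lam p q)⁻¹ p)

end JFamily

/-!
By its lambda maps, `B'` acts on the `λ`-stable set `X'`. As the order of `t` is coprime to the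
exponent of `A`, the set `X'` generates the additive group of `B'`; hence the kernel of the action
is the socle, its image is the permutation group, and `𝒢(X', r') ≅ B' / soc B'`. The action of `A₁`
on `H'` is faithful, so the socle is the radical of `b'`.

If `B' ≅ B' / soc B'`, a nonzero `f` in the radical of `b'` gives a socle element `(f, 1)` of `B'`
and, through the isomorphism, a socle element of `B' / soc B'`. Modulo the socle, the `λ`-orbit of
the latter only depends on its `A₁`-coordinate, so it is finite because `T` is, whereas `f` has
infinitely many translates when `A` is infinite. So `A` and `B'` are finite, and comparing
cardinalities the socle is trivial.
-/

theorem map_add_of_closure_eq_top {G H : Type*} [AddGroup G] [AddGroup H] {X : Set G}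
    (hX : AddSubgroup.closure X = ⊤) {f : G → H} (h_zero : f 0 = 0)
    (h_add : ∀ g, ∀ x ∈ X, f (g + x) = f g + f x) (g h : G) : f (g + h) = f g + f h := by
  have h_sub : ∀ k, ∀ x ∈ X, f (k + -x) = f k - f x := fun k x hx => by
    rw [eq_sub_iff_add_eq, ← h_add _ x hx, neg_add_cancel_right]
  have hh : h ∈ AddSubgroup.closure X := hX ▸ AddSubgroup.mem_top h
  induction hh using AddSubgroup.closure_induction_right with
  | zero => rw [h_zero, add_zero, add_zero]
  | add_right k _ x hx ih => rw [← add_assoc, h_add _ x hx, ih, h_add k x hx, add_assoc]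
  | add_neg_cancel k _ x hx ih =>
    rw [← add_assoc, h_sub _ x hx, ih, h_sub k x hx, add_sub_assoc]

theorem closure_range_single_one_prod_eq_top {ι T : Type*} [Nonempty ι] [AddGroup T] {n : ℕ}
    {τ : T} (hτ : AddSubgroup.zmultiples τ = ⊤) (hn : n.Coprime (addOrderOf τ)) :
    AddSubgroup.closure (Set.range fun i : ι => (Finsupp.single i (1 : ZMod n), τ)) = ⊤ := by
  set K := AddSubgroup.closure (Set.range fun i : ι => (Finsupp.single i (1 : ZMod n), τ))
  have single_τ_mem (i : ι) : (Finsupp.single i 1, τ) ∈ K := AddSubgroup.subset_closure ⟨i, rfl⟩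
  -- Multiplication by `n` kills the first coordinate and is invertible on the multiples of `τ`.
  have zero_τ_mem : (0, τ) ∈ K := by
    obtain ⟨i⟩ := ‹Nonempty ι›
    obtain ⟨m, hm⟩ := exists_nsmul_eq_self_of_coprime hn
    have h := K.nsmul_mem (K.nsmul_mem (single_τ_mem i) n) m
    rwa [Prod.smul_mk, Prod.smul_mk, hm, Finsupp.smul_single, nsmul_one, ZMod.natCast_self,
      Finsupp.single_zero, smul_zero] at h
  have zero_mem (u : T) : (0, u) ∈ K := by
    obtain ⟨z, rfl⟩ := AddSubgroup.mem_zmultiples_iff.1 (hτ ▸ AddSubgroup.mem_top u)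
    simpa only [Prod.smul_mk, smul_zero] using K.zsmul_mem zero_τ_mem z
  have mem_zero (f : ι →₀ ZMod n) : (f, 0) ∈ K := by
    induction f using Finsupp.induction_linear with
    | zero => exact K.zero_mem
    | add f g hf hg => simpa only [Prod.mk_add_mk, add_zero] using K.add_mem hf hg
    | single i m =>
      obtain ⟨m, rfl⟩ := ZMod.intCast_surjective m
      simpa using K.zsmul_mem (K.sub_mem (single_τ_mem i) zero_τ_mem) m
  refine (AddSubgroup.eq_top_iff' _).2 fun w => ?_
  simpa only [Prod.mk_add_mk, add_zero, zero_add] using K.add_mem (mem_zero w.1) (zero_mem w.2)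

theorem isOfFinOrder_of_coprime_exponent {A : Type*} [AddCommGroup A] {t : A ≃ₗ[ℤ] A}
    (ht : (orderOf t).Coprime (AddMonoid.exponent A)) : IsOfFinOrder t := by
  rw [← orderOf_ne_zero_iff]
  -- Infinite order is encoded as `0`, which is coprime to the exponent only if `A` is trivial.
  intro h
  rw [h, Nat.coprime_zero_left] at ht
  have := AddMonoid.exp_eq_one_iff.1 ht
  simp [Subsingleton.elim t 1] at h

theorem finite_of_finite_range_translate {G M : Type*} [AddGroup G] [Zero M] {f : G →₀ M}
    (hf : f ≠ 0) (h : (Set.range fun a x : G => f (x - a)).Finite) : Finite G := by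
  obtain ⟨x, hx⟩ := Finsupp.ne_iff.1 hf
  have hfin : (⋃ k ∈ Set.range fun a x : G => f (x - a), Function.support k).Finite :=
    h.biUnion <| Set.forall_mem_range.2 fun a =>
      f.hasFiniteSupport.preimage (sub_left_injective (b := a)).injOn
  refine Set.finite_univ_iff.1 (hfin.subset fun y _ => ?_)
  refine Set.mem_biUnion ⟨-x + y, rfl⟩ ?_
  simpa [sub_eq_add_neg] using hx

namespace LeftBrace

variable {B C : Type*} [LeftBrace B] [LeftBrace C]

theorem map_lam (e : B ≃+* C) (a b : B) : e (lam a b) = lam (e a) (e b) := by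
  rw [lam_apply, lam_apply, map_add, map_neg, map_mul]

theorem mem_socle_iff {a : B} : a ∈ (socle B).toSubgroup ↔ ∀ b, lam a b = b :=
  mul_eq_add_iff a

theorem map_mem_socle (e : B ≃+* C) {a : B} (ha : a ∈ (socle B).toSubgroup) :
    e a ∈ (socle C).toSubgroup := by
  rw [mem_socle_iff] at ha ⊢
  intro c
  obtain ⟨b, rfl⟩ := e.surjective c
  rw [← map_lam, ha]

theorem neg_eq_inv_lam (a : B) : -a = (lam (-a)⁻¹ a)⁻¹ := by
  refine eq_inv_of_mul_eq_one_left ?_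
  rw [← add_lam, lam_lam_inv, neg_add_cancel, one_eq_zero]

namespace Ideal

variable (I : Ideal B)

theorem toQuot_lam (a b : B) : I.toQuot (lam a b) = lam (I.toQuot a) (I.toQuot b) := rfl

theorem toQuot_eq_iff_neg_add_mem {a b : B} :
    I.toQuot a = I.toQuot b ↔ -a + b ∈ I.toSubgroup :=
  QuotientAddGroup.eq

/-- The first isomorphism theorem for left braces. -/
noncomputable def quotientEquivOfSurjective (φ : B →+ C) (hmul : ∀ a b, φ (a * b) = φ a * φ b)
    (hker : ∀ a, φ a = 0 ↔ a ∈ I.toSubgroup) (hφ : Function.Surjective φ) :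
    I.Quotient ≃+* C :=
  let e : I.Quotient ≃+ C := QuotientAddGroup.liftEquiv I.toAddSubgroup hφ
    (AddSubgroup.ext fun a => (hker a).symm)
  { e with
    map_mul' := fun x y => by
      obtain ⟨a, rfl⟩ := I.toQuot_surjective x
      obtain ⟨b, rfl⟩ := I.toQuot_surjective y
      exact hmul a b }

theorem eq_one_of_mem_of_equiv [Finite B] (e : B ≃ I.Quotient) {a : B}
    (ha : a ∈ I.toSubgroup) : a = 1 := by
  have hinj : Function.Injective I.toQuot :=
    Function.Surjective.injective_of_finite e I.toQuot_surjective
  exact hinj (I.toQuot_eq_iff.2 (by simpa using ha))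

end Ideal

/-- A left brace with trivial socle is its own quotient by the socle. -/
noncomputable def equivSocleQuotient (h : ∀ a ∈ (socle B).toSubgroup, a = 0) :
    B ≃+* (socle B).Quotient :=
  ((socle B).quotientEquivOfSurjective (AddMonoidHom.id B) (fun _ _ => rfl)
    (fun a => ⟨fun ha : a = 0 => ha ▸ (socle B).toAddSubgroup.zero_mem, h a⟩)
    Function.surjective_id).symm

section Generators

variable {X : Set B} (hX : ∀ a x, lam a x ∈ X ↔ x ∈ X)

include hX in
theorem subgroupClosure_eq_top (hgen : AddSubgroup.closure X = ⊤) : Subgroup.closure X = ⊤ := by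
  refine (Subgroup.eq_top_iff' _).2 fun g => ?_
  have hg : g ∈ AddSubgroup.closure X := hgen ▸ AddSubgroup.mem_top g
  induction hg using AddSubgroup.closure_induction_right with
  | zero => exact one_eq_zero (B := B) ▸ one_mem _
  | add_right g _ x hx ih =>
    rw [add_eq_mul_lam]
    exact mul_mem ih (Subgroup.subset_closure ((hX _ _).2 hx))
  | add_neg_cancel g _ x hx ih =>
    rw [add_eq_mul_lam, map_neg, neg_eq_inv_lam]
    exact mul_mem ih (inv_mem (Subgroup.subset_closure ((hX _ _).2 ((hX _ _).2 hx))))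

/-- The restriction of the solution of the Yang–Baxter equation associated to a left brace to a
`λ`-stable subset. -/
noncomputable def solutionOn : YBESolution X :=
  (solution B).restrict X hX fun a b => hX (lam a b)⁻¹ a

/-- The action of a left brace on a `λ`-stable subset by its lambda maps. -/
def lamPerm : B →* Equiv.Perm X where
  toFun a := Equiv.Perm.subtypePerm (lam a).toEquiv (hX a)
  map_one' := Equiv.ext fun x => Subtype.ext (lam_one x.1)
  map_mul' a b := Equiv.ext fun x => Subtype.ext (lam_mul a b x.1)

theorem lamPerm_coe (x : X) : lamPerm hX x = (solutionOn hX).sigma x := Equiv.ext fun _ => rfl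

variable (hgen : AddSubgroup.closure X = ⊤)
include hgen

theorem lamPerm_eq_one_iff (a : B) : lamPerm hX a = 1 ↔ a ∈ (socle B).toSubgroup := by
  rw [mem_socle_iff]
  refine ⟨fun h => ?_, fun h => Equiv.ext fun x => Subtype.ext (h x)⟩
  have hlam : (lam a).toAddMonoidHom = AddMonoidHom.id B :=
    AddMonoidHom.eq_of_eqOn_dense hgen fun x hx =>
      congrArg Subtype.val (Equiv.congr_fun h ⟨x, hx⟩)
  exact DFunLike.congr_fun hlam

theorem range_lamPerm :
    (lamPerm hX).range = Subgroup.closure (Set.range (solutionOn hX).sigma) := by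
  have himage : lamPerm hX '' X = Set.range (solutionOn hX).sigma := by
    rw [Set.image_eq_range]
    exact congrArg Set.range (funext (lamPerm_coe hX))
  rw [MonoidHom.range_eq_map, ← subgroupClosure_eq_top hX hgen, MonoidHom.map_closure, himage]

/-- The homomorphism `a ↦ λ_a` onto the permutation group of the solution on a `λ`-stable set of
additive generators. -/
noncomputable def toPermGroup : B →* (solutionOn hX).PermGroup :=
  (MulEquiv.subgroupCongr (range_lamPerm hX hgen)).toMonoidHom.comp (lamPerm hX).rangeRestrict

theorem toPermGroup_coe (x : X) :
    toPermGroup hX hgen x = YBESolution.PermGroup.of (solutionOn hX) x :=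
  Subtype.ext (lamPerm_coe hX x)

theorem toPermGroup_surjective : Function.Surjective (toPermGroup hX hgen) :=
  (MulEquiv.subgroupCongr (range_lamPerm hX hgen)).surjective.comp
    (lamPerm hX).rangeRestrict_surjective

theorem toPermGroup_eq_zero_iff (a : B) :
    toPermGroup hX hgen a = 0 ↔ a ∈ (socle B).toSubgroup := by
  rw [← one_eq_zero, ← lamPerm_eq_one_iff hX hgen]
  exact Subtype.ext_iff

theorem toPermGroup_add (a b : B) :
    toPermGroup hX hgen (a + b) = toPermGroup hX hgen a + toPermGroup hX hgen b := by
  refine map_add_of_closure_eq_top hgen ?_ (fun a x hx => ?_) a b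
  · rw [← one_eq_zero, map_one, one_eq_zero]
  · lift x to X using hx
    have h_add := (solutionOn hX).permGroupGenerated.add_ι (toPermGroup hX hgen a) x
    rw [YBESolution.GeneratedGroup.shift_apply, ← map_inv] at h_add
    rw [toPermGroup_coe, add_eq_mul_lam, map_mul]
    exact (congrArg _ (toPermGroup_coe hX hgen ⟨lam a⁻¹ x, (hX _ _).2 x.2⟩)).trans h_add.symm

/-- The permutation group of the solution on a `λ`-stable set of additive generators of a left
brace is the quotient by the socle. -/
noncomputable def socleQuotientEquivPermGroup :
    (socle B).Quotient ≃+* (solutionOn hX).PermGroup :=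
  (socle B).quotientEquivOfSurjective (AddMonoidHom.mk' _ (toPermGroup_add hX hgen))
    (map_mul (toPermGroup hX hgen)) (toPermGroup_eq_zero_iff hX hgen)
    (toPermGroup_surjective hX hgen)

end Generators

end LeftBrace

namespace AsymData

variable {H S : Type*} [AddCommGroup H] [LeftBrace S] (D : AsymData H S)

/-- The action `α` of an asymmetric product is faithful. -/
def IsFaithful : Prop := ∀ s, (∀ h, D.α s h = h) → s = 1

theorem b_α_eq_zero {f : H} (hf : ∀ h, D.b f h = 0) (s : S) (h : H) : D.b (D.α s f) h = 0 := by
  obtain ⟨k, rfl⟩ := (D.α s).surjective h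
  rw [← D.lam_b, hf, map_zero]

namespace Product

variable {D}

theorem lam_def (p q : D.Product) :
    LeftBrace.lam p q =
      ⟨D.α p.snd q.fst, LeftBrace.lam p.snd q.snd - D.b p.fst (D.α p.snd q.fst)⟩ := by
  rw [LeftBrace.lam_apply]
  ext1
  · simp
  · simp only [add_snd, neg_snd, neg_fst, mul_snd, mul_fst, D.neg_b, D.add_b, LeftBrace.lam_apply]
    abel

theorem mem_socle_iff (hα : D.IsFaithful) {p : D.Product} :
    p ∈ (LeftBrace.socle D.Product).toSubgroup ↔ p.snd = 1 ∧ ∀ h, D.b p.fst h = 0 := by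
  rw [LeftBrace.mem_socle_iff]
  constructor
  · intro hp
    have hfst (h : H) : D.α p.snd h = h := by
      simpa only [lam_def] using congrArg fst (hp ⟨h, 0⟩)
    have hsnd (h : H) : D.b p.fst (D.α p.snd h) = 0 := by
      simpa only [lam_def, map_zero, zero_sub, neg_eq_zero] using congrArg snd (hp ⟨h, 0⟩)
    exact ⟨hα _ hfst, fun h => hfst h ▸ hsnd h⟩
  · rintro ⟨hs, hb⟩ q
    rw [lam_def, hs, hb, sub_zero, D.α_one, LeftBrace.lam_one]

theorem toQuot_socle_eq_iff (hα : D.IsFaithful) {p q : D.Product} :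
    (LeftBrace.socle D.Product).toQuot p = (LeftBrace.socle D.Product).toQuot q ↔
      p.snd = q.snd ∧ ∀ h, D.b p.fst h = D.b q.fst h := by
  rw [LeftBrace.Ideal.toQuot_eq_iff_neg_add_mem, mem_socle_iff hα]
  have hfst : (∀ h, D.b (-p + q).fst h = 0) ↔ ∀ h, D.b p.fst h = D.b q.fst h := by
    simp only [add_fst, neg_fst, D.b_add, D.neg_b, neg_add_eq_zero]
  rw [hfst]
  refine and_congr_left fun hb => ?_
  have hpq : D.b p.fst q.fst = D.b p.fst p.fst := by rw [D.b_symm, hb]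
  rw [add_snd, neg_snd, neg_fst, D.neg_b, hpq, LeftBrace.one_eq_zero, add_right_comm,
    add_neg_cancel_right, neg_add_eq_zero]

theorem b_fst_eq_zero_of_toQuot_mem_socle (hα : D.IsFaithful) {x : D.Product}
    (hx : (LeftBrace.socle D.Product).toQuot x ∈
      (LeftBrace.socle (LeftBrace.socle D.Product).Quotient).toSubgroup) (h : H) :
    D.b x.fst h = 0 := by
  obtain ⟨k, rfl⟩ := (D.α x.snd).surjective h
  have hk := LeftBrace.mem_socle_iff.1 hx ((LeftBrace.socle D.Product).toQuot ⟨k, 0⟩)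
  rw [← LeftBrace.Ideal.toQuot_lam, toQuot_socle_eq_iff hα] at hk
  simpa only [lam_def, map_zero, zero_sub, neg_eq_zero] using hk.1

theorem finite_range_lam_of_mem_socle (hα : D.IsFaithful)
    (hS : ∀ s : S, (Set.range fun u => LeftBrace.lam u s).Finite)
    {z : (LeftBrace.socle D.Product).Quotient} (hz : z ∈ (LeftBrace.socle _).toSubgroup) :
    (Set.range fun q => LeftBrace.lam q z).Finite := by
  obtain ⟨x, rfl⟩ := (LeftBrace.socle D.Product).toQuot_surjective z
  have hb := b_fst_eq_zero_of_toQuot_mem_socle hα hz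
  refine ((hS x.snd).image fun s => (LeftBrace.socle D.Product).toQuot ⟨0, s⟩).subset ?_
  rintro _ ⟨q, rfl⟩
  obtain ⟨p, rfl⟩ := (LeftBrace.socle D.Product).toQuot_surjective q
  refine ⟨_, ⟨p.snd, rfl⟩, ?_⟩
  have hbα := D.b_α_eq_zero hb p.snd
  dsimp only
  rw [← LeftBrace.Ideal.toQuot_lam, toQuot_socle_eq_iff hα, lam_def]
  exact ⟨by rw [D.b_symm, hbα, sub_zero], fun h => by rw [D.zero_b, hbα]⟩

theorem finite_range_α_of_equiv (hα : D.IsFaithful)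
    (hS : ∀ s : S, (Set.range fun u => LeftBrace.lam u s).Finite)
    (e : D.Product ≃+* (LeftBrace.socle D.Product).Quotient) {f : H} (hf : ∀ h, D.b f h = 0) :
    (Set.range fun s => D.α s f).Finite := by
  have hmem : (⟨f, 1⟩ : D.Product) ∈ (LeftBrace.socle D.Product).toSubgroup :=
    (mem_socle_iff hα).2 ⟨rfl, hf⟩
  have horbit := finite_range_lam_of_mem_socle hα hS (LeftBrace.map_mem_socle e hmem)
  refine (horbit.image fun z => (e.symm z).fst).subset ?_
  rintro _ ⟨s, rfl⟩
  refine ⟨_, ⟨e ⟨0, s⟩, rfl⟩, ?_⟩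
  dsimp only
  rw [← LeftBrace.map_lam, RingEquiv.symm_apply_apply, lam_def]

instance [Finite H] [Finite S] : Finite D.Product :=
  Finite.of_injective (fun p : D.Product => (p.fst, p.snd)) fun _ _ h =>
    Product.ext (congrArg Prod.fst h) (congrArg Prod.snd h)

end Product

end AsymData

namespace SemiBrace

variable {A : Type*} [AddCommGroup A] {t : A ≃ₗ[ℤ] A}

theorem lam_def (p q : SemiBrace t) : LeftBrace.lam p q = ⟨p.snd.1 q.fst, q.snd⟩ := by
  rw [LeftBrace.lam_apply]
  ext1 <;> simp

variable [Finite (Subgroup.zpowers t)]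

theorem finite_range_lam (p : SemiBrace t) : (Set.range fun q => LeftBrace.lam q p).Finite := by
  refine (Set.finite_range fun u : Subgroup.zpowers t =>
    (⟨u.1 p.fst, p.snd⟩ : SemiBrace t)).subset ?_
  rintro _ ⟨q, rfl⟩
  exact ⟨q.snd, (lam_def q p).symm⟩

instance [Finite A] : Finite (SemiBrace t) :=
  Finite.of_injective (fun p : SemiBrace t => (p.fst, p.snd)) fun _ _ h =>
    SemiBrace.ext (congrArg Prod.fst h) (congrArg Prod.snd h)

end SemiBrace

namespace JFamily

variable {A : Type*} [AddCommGroup A] (D : JFamily A)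

theorem shift_one : D.shift 1 = 0 := by
  have h : (1 : D.T).1 (D.t (D.j 0)) - D.t (D.j 0) = 0 := sub_self _
  rw [shift, h, map_zero, map_zero]

theorem α'_translation_apply (a : A) (f : D.H') (x : A) : D.α' ⟨a, 1⟩ f x = f (x - a) := by
  rw [α'_apply]
  congr 1
  change x - a - D.shift 1 = x - a
  rw [shift_one, sub_zero]

theorem asymData_isFaithful : D.asymData.IsFaithful := by
  intro p hp
  cases subsingleton_or_nontrivial A with
  | inl _ => exact SemiBrace.ext (Subsingleton.elim _ _) (Subsingleton.elim _ _)
  | inr _ =>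
    have : Nontrivial (ZMod (AddMonoid.exponent A)) :=
      ZMod.nontrivial_iff.2 (mt AddMonoid.exp_eq_one_iff.1 (not_subsingleton A))
    have hg (x : A) : p.snd.1 x + p.fst + D.shift p.snd = x := by
      refine Finsupp.single_left_injective (one_ne_zero (α := ZMod (AddMonoid.exponent A))) ?_
      exact (Finsupp.equivMapDomain_single _ _ _).symm.trans (hp (Finsupp.single x 1))
    have h_zero : p.fst + D.shift p.snd = 0 := by simpa using hg 0
    have hu : p.snd = 1 := Subtype.ext <| LinearEquiv.ext fun x => by
      have hx := hg x
      rwa [add_assoc, h_zero, add_zero] at hx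
    refine SemiBrace.ext ?_ hu
    rwa [hu, shift_one, add_zero] at h_zero

theorem mem_socle_iff {x : D.B'} :
    x ∈ (LeftBrace.socle D.B').toSubgroup ↔
      ∃ f : D.H', x = ⟨f, ⟨0, 1⟩⟩ ∧ ∀ h : D.H', D.b' f h = ⟨0, 1⟩ := by
  refine (AsymData.Product.mem_socle_iff D.asymData_isFaithful).trans
    ⟨fun h => ⟨x.fst, AsymData.Product.ext rfl h.1, h.2⟩, ?_⟩
  rintro ⟨f, rfl, hf⟩
  exact ⟨rfl, hf⟩

theorem eq_zero_of_equiv [Finite D.T] (e : D.B' ≃+* (LeftBrace.socle D.B').Quotient) {f : D.H'}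
    (hf : ∀ h, D.b' f h = ⟨0, 1⟩) : f = 0 := by
  by_contra hne
  have hfin : Finite A := by
    refine finite_of_finite_range_translate hne ?_
    have hα := AsymData.Product.finite_range_α_of_equiv D.asymData_isFaithful
      SemiBrace.finite_range_lam e hf
    refine (hα.image DFunLike.coe).subset ?_
    rintro _ ⟨a, rfl⟩
    exact ⟨_, ⟨⟨a, 1⟩, rfl⟩, funext (D.α'_translation_apply a f)⟩
  have : NeZero (AddMonoid.exponent A) := ⟨AddMonoid.exponent_ne_zero_of_finite⟩
  have : Finite D.H' := Finite.of_injective _ DFunLike.coe_injective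
  have hmem : (⟨f, ⟨0, 1⟩⟩ : D.B') ∈ (LeftBrace.socle D.B').toSubgroup :=
    D.mem_socle_iff.2 ⟨f, rfl, hf⟩
  exact hne (congrArg AsymData.Product.fst
    (LeftBrace.Ideal.eq_one_of_mem_of_equiv _ e.toEquiv hmem))

/-- The projection of `B'` onto the additive group `H' × T`, which forgets the `A`-coordinate, the
only one in which the form `b'` twists the addition. -/
def toProd : D.B' →+ D.H' × Additive D.T where
  toFun p := (p.fst, Additive.ofMul p.snd.snd)
  map_zero' := rfl
  map_add' p q := Prod.ext rfl (congrArg Additive.ofMul (mul_one (p.snd.snd * q.snd.snd)))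

theorem ker_toProd_le_closure_X' : D.toProd.ker ≤ AddSubgroup.closure D.X' := by
  intro p hp
  obtain ⟨f, c, u⟩ := p
  obtain ⟨rfl, rfl⟩ : f = 0 ∧ u = 1 := Prod.ext_iff.1 hp
  have hadd : D.x' 0 0 + ⟨0, ⟨c, 1⟩⟩ = D.x' 0 c := by
    refine AsymData.Product.ext (add_zero _) ?_
    rw [AsymData.Product.add_snd, D.asymData.b_zero, add_zero]
    refine SemiBrace.ext ?_ (mul_one _)
    change 0 - D.t (D.tSub.symm (D.j 0)) + c = c - D.t (D.tSub.symm (D.j 0))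
    abel
  have hX (c : A) : D.x' 0 c ∈ AddSubgroup.closure D.X' :=
    AddSubgroup.subset_closure ⟨0, c, rfl⟩
  exact (AddSubgroup.add_mem_cancel_left _ (hX 0)).1 (hadd ▸ hX c)

theorem closure_X' (ht : Nat.Coprime (orderOf D.t) (AddMonoid.exponent A)) :
    AddSubgroup.closure D.X' = ⊤ := by
  let τ : D.T := ⟨D.t, Subgroup.mem_zpowers D.t⟩
  have hτ : AddSubgroup.zmultiples (Additive.ofMul τ) = ⊤ := by
    refine (AddSubgroup.eq_top_iff' _).2 fun ⟨_, z, hz⟩ => ?_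
    exact ⟨z, congrArg Additive.ofMul (Subtype.ext hz)⟩
  have hmap : (AddSubgroup.closure D.X').map D.toProd = ⊤ := by
    rw [AddMonoidHom.map_closure, eq_top_iff, ← closure_range_single_one_prod_eq_top (ι := A) hτ
      (by rwa [addOrderOf_ofMul_eq_orderOf, Subgroup.orderOf_mk, Nat.coprime_comm])]
    refine AddSubgroup.closure_mono ?_
    rintro _ ⟨a, rfl⟩
    exact ⟨D.x' a 0, ⟨a, 0, rfl⟩, rfl⟩
  rw [← sup_eq_left.2 D.ker_toProd_le_closure_X', ← AddSubgroup.comap_map_eq, hmap,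
    AddSubgroup.comap_top]

end JFamily

theorem proposition4p4 {A : Type*} [AddCommGroup A] (D : JFamily A)
    (hn : 1 < AddMonoid.exponent A)
    (ht : Nat.Coprime (orderOf D.t) (AddMonoid.exponent A)) :
    Nonempty ((LeftBrace.socle D.B').Quotient ≃+* D.solution.PermGroup) ∧
    ((LeftBrace.socle D.B').carrier =
      {x : D.B' | ∃ f : D.H', x = ⟨f, ⟨0, 1⟩⟩ ∧ ∀ h : D.H', D.b' f h = ⟨0, 1⟩}) ∧
    (Nonempty (D.B' ≃+* D.solution.PermGroup) ↔
      ∀ f : D.H', (∀ h : D.H', D.b' f h = ⟨0, 1⟩) → f = 0) := by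
  let e : (LeftBrace.socle D.B').Quotient ≃+* D.solution.PermGroup :=
    LeftBrace.socleQuotientEquivPermGroup D.lam_mem_X'_iff (D.closure_X' ht)
  refine ⟨⟨e⟩, Set.ext fun _ => D.mem_socle_iff, ?_, fun hb => ?_⟩
  · rintro ⟨e'⟩ f hf
    have : Finite D.T := (isOfFinOrder_of_coprime_exponent ht).finite_zpowers
    exact D.eq_zero_of_equiv (e'.trans e.symm) hf
  · refine ⟨(LeftBrace.equivSocleQuotient fun a ha => ?_).trans e⟩
    obtain ⟨f, rfl, hf⟩ := D.mem_socle_iff.1 ha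
    exact congrArg (AsymData.Product.mk · 1) (hb f hf)
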